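/- The Fibonacci tree $\mathbf{T}_{(1,1)}$ is the infinite tree of nonnegative integers whose root is a node $1$ with a single child $1$, and in which every node with value $y$ whose parent has value $x$ has two children: a left child with value $|x-y|$ and a right child with value $x+y$. The parent-child pair formed by the root and its child has depth $0$, and each further branch increases the depth of the pair by one, so there are $2^d$ parent-child pairs at depth $d$. For $n\ge 0$ let $A_{(1,1)}(n)$ be the number of parent-child pairs at depth $3n$ (counted as positions in the tree) whose parent and child both have value $1$. Write $6.75=\frac{27}{4}$. Theorem. We have $$A_{(1,1)}(n)=\frac{243\cdot 6.75^n}{4\sqrt{3\pi}\,n^{3/2}}-\frac{337041\cdot 6.75^n}{288\sqrt{3\pi}\,n^{5/2}}+O\left(\frac{6.75^n}{n^{7/2}}\right)\qquad(n\to\infty),$$ and for every integer $n\ge 1$ the error term equals $c_n\cdot\frac{6.75^n}{n^{7/2}}$ with $$0<c_n<\frac{1348164}{36\sqrt{3\pi}}.$$ In particular, for all sufficiently large $n$, $$\frac{243\cdot 6.75^n}{4\sqrt{3\pi}\,n^{3/2}}\left(1-\frac{1387}{72n}\right)<A_{(1,1)}(n)<\frac{243\cdot 6.75^n}{4\sqrt{3\pi}\,n^{3/2}}\left(1-\frac{1387}{72n}+\frac{5548}{9n^2}\right).$$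 -/

import Mathlib

/-- One branch in a Fibonacci tree. From a parent-child pair `(x, y)` the left branch (`false`)
leads to the pair `(y, |x - y|)` and the right branch (`true`) to the pair `(y, x + y)`. -/
def fibStep (p : ℕ × ℕ) (right : Bool) : ℕ × ℕ :=
  if right then (p.2, p.1 + p.2) else (p.2, Nat.dist p.1 p.2)

/-- The parent-child pair reached in the Fibonacci tree `T_{(g₀, g₁)}`, `g = (g₀, g₁)`, by
starting from the root pair `g` and taking the branches listed in `w`, in this order. -/
def fibPair (g : ℕ × ℕ) (w : List Bool) : ℕ × ℕ :=
  w.foldl fibStep g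

/-- The number of pairs `(a, b)` at depth `d` of the tree `T_{(1, 1)}`. Each of the `2 ^ d`
sequences of `d` left / right branches leads to its own place in the tree, so pairs are counted
by branch sequences (two sequences may pass through the same numbers). -/
def pairsAtDepth (a b d : ℕ) : ℕ :=
  (Finset.univ.filter fun w : Fin d → Bool => fibPair (1, 1) (List.ofFn w) = (a, b)).card

/-- The residue modulo `3` of the depths at which the pair `(a, b)` can occur: `0` if `a` and `b`
are odd, `1` if `a` is odd and `b` is even, `2` if `a` is even and `b` is odd.
(Pairs with `a` and `b` both even do not occur in the tree.) -/
def depthResidue (a b : ℕ) : ℕ :=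
  if Even a then 2 else if Even b then 1 else 0

/-- `A_{(a, b)}(n)`, the number of pairs `(a, b)` at depth `3 n + m` of the tree `T_{(1, 1)}`,
where `m` is determined by the parities of `a` and `b`. -/
def fibPairCount (a b n : ℕ) : ℕ :=
  pairsAtDepth a b (3 * n + depthResidue a b)

open Finset Filter Topology

/-! A right branch followed by two left ones restores the pair. So a pair of positive integers that
left branches lead to (1, 1) has a level, the number of left branches needed: right raises it by 2,
left lowers it by 1. A left branch at level 0 starts a detour through (1, 0) and (0, 1), back at (1,
1) after three steps in four ways. Hence the number of returns depends only on level and length, and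
`doubleWalkCount` solves its recursion. This gives 2A(n) = (n+4)S - (2n+2)C, where C = C(3n+2, n)
and S is the sum of row 3n+2 up to C (`two_mul_fibPairCount`).

The recurrence for S multiplies it by 8, while S and C are O((27/4)^n). An error of the wrong sign
in a proposed bound for S would grow like 8^n, which is impossible (`nonneg_of_succ_le_mul`). So A =
(18/n)(1 - 56/(3n) + O(1/n^2))C. Stirling's formula and monotone quotients give C = L(27/4)^n
n^(-1/2)(1 - 43/(72n) + O(1/n^2)) with L = 27/(8√(3π)). Multiplying, 56/3 + 43/72 = 1387/72 and 18L
= 243/(4√(3π)). -/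

/-! ### Levels of pairs. -/

/-- The number of branch sequences of length `d` leading from the pair `p` to the pair `(1, 1)`. -/
def returnCount (p : ℕ × ℕ) (d : ℕ) : ℕ :=
  (univ.filter fun w : Fin d → Bool => fibPair p (List.ofFn w) = (1, 1)).card

theorem returnCount_zero (p : ℕ × ℕ) : returnCount p 0 = if p = (1, 1) then 1 else 0 := by
  by_cases h : p = (1, 1) <;> simp [returnCount, fibPair, h]

theorem returnCount_succ (p : ℕ × ℕ) (d : ℕ) :
    returnCount p (d + 1) =
      returnCount (fibStep p true) d + returnCount (fibStep p false) d := by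
  simp only [returnCount, card_filter]
  rw [← (Fin.consEquiv fun _ : Fin (d + 1) => Bool).sum_comp, Fintype.sum_prod_type,
    Fintype.sum_bool]
  simp only [Fin.consEquiv, Equiv.coe_fn_mk, List.ofFn_cons, fibPair, List.foldl_cons]
  rfl

/-- The pair `p` consists of positive integers and reaches `(1, 1)` for the first time after
exactly `k` left branches. -/
def HasLevel : ℕ → ℕ × ℕ → Prop
  | 0, p => p = (1, 1)
  | k + 1, p => p ≠ (1, 1) ∧ 0 < p.1 ∧ 0 < p.2 ∧ HasLevel k (fibStep p false)

theorem HasLevel.pos {k : ℕ} {p : ℕ × ℕ} (h : HasLevel k p) : 0 < p.1 ∧ 0 < p.2 := by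
  cases k with
  | zero => simp only [HasLevel] at h; simp [h]
  | succ k => exact ⟨h.2.1, h.2.2.1⟩

/-- Two left branches undo a right one: (b, a+b), (a+b, a), (a, b). -/
theorem HasLevel.right {k : ℕ} {p : ℕ × ℕ} (h : HasLevel k p) :
    HasLevel (k + 2) (fibStep p true) := by
  obtain ⟨a, b⟩ := p
  obtain ⟨ha, hb⟩ := h.pos
  simp only at ha hb
  have h1 : b.dist (a + b) = a := by simp [Nat.dist]
  have h2 : (a + b).dist a = b := by simp [Nat.dist]
  refine ⟨?_, ?_, ?_, ?_, ?_, ?_, ?_⟩ <;> simp [fibStep, h1, h2, ha, hb]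
  · omega
  · omega
  · exact h

/-- One branch lowers the level by at most 1. -/
theorem returnCount_eq_zero {k d : ℕ} {p : ℕ × ℕ} (h : HasLevel k p) (hd : d < k) :
    returnCount p d = 0 := by
  induction d generalizing k p with
  | zero =>
    obtain ⟨k, rfl⟩ := Nat.exists_eq_add_of_lt hd
    rw [returnCount_zero, if_neg]
    rw [Nat.zero_add] at h
    exact h.1
  | succ d ih =>
    obtain ⟨k, rfl⟩ : ∃ j, k = j + 1 := ⟨k - 1, by omega⟩
    rw [returnCount_succ, ih h.right (by omega), ih h.2.2.2 (by omega)]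

/-! ### Exact count by partial row sums. -/

/-- The sum of the first `m + 1` binomial coefficients in row `N`. -/
def partialRowSum (N m : ℕ) : ℤ :=
  ∑ i ∈ range (m + 1), (N.choose i : ℤ)

theorem partialRowSum_zero (N : ℕ) : partialRowSum N 0 = 1 := by simp [partialRowSum]

theorem partialRowSum_succ_right (N m : ℕ) :
    partialRowSum N (m + 1) = partialRowSum N m + N.choose (m + 1) := by
  rw [partialRowSum, sum_range_succ, partialRowSum]

theorem partialRowSum_succ_left (N m : ℕ) :
    partialRowSum (N + 1) m = 2 * partialRowSum N m - N.choose m := by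
  induction m with
  | zero => simp [partialRowSum_zero]
  | succ m ih =>
    rw [partialRowSum_succ_right, ih, partialRowSum_succ_right, Nat.choose_succ_succ]
    push_cast
    ring

/-- Twice the number of walks of length `d` with steps `+2` and `-1`, of which `m` are `+2`,
that descend in the levels of the tree to the pair `(1, 1)`. -/
def doubleWalkCount (d m : ℕ) : ℤ :=
  ((d : ℤ) + 4 - 2 * m) * partialRowSum (d + 2) m - (d + 2) * (d + 1).choose m

theorem doubleWalkCount_zero (d : ℕ) : doubleWalkCount d 0 = 2 := by
  simp [doubleWalkCount, partialRowSum_zero]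

/-- This matches the split by the first branch: with d = k + 3m, a left branch keeps m and a right
branch lowers it by 1. -/
theorem doubleWalkCount_succ_succ (d m : ℕ) :
    doubleWalkCount (d + 1) (m + 1) = doubleWalkCount d (m + 1) + doubleWalkCount d m := by
  simp only [doubleWalkCount]
  rw [show d + 1 + 2 = (d + 2) + 1 by ring, partialRowSum_succ_left, partialRowSum_succ_right,
    Nat.choose_succ_succ' (d + 1) m]
  push_cast
  ring

theorem choose_three_mul_succ (m : ℕ) :
    (3 * m + 2).choose (m + 1) = 2 * (3 * m + 2).choose m := by
  have h := Nat.choose_succ_right_eq (3 * m + 2) m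
  rw [show 3 * m + 2 - m = 2 * (m + 1) by omega] at h
  refine Nat.eq_of_mul_eq_mul_right (Nat.succ_pos m) ?_
  rw [Nat.succ_eq_add_one, h]
  ring

theorem choose_three_mul_pred (m : ℕ) :
    (3 * m + 2) * (3 * m + 1).choose m = (2 * m + 2) * (3 * m + 2).choose m := by
  have h := Nat.choose_mul_succ_eq (3 * m + 1) m
  rw [show 3 * m + 1 + 1 - m = 2 * m + 2 by omega] at h
  linarith

/-- The boundary condition at level 0: the value at the fictitious level -1 must account for the
detour, which uses three steps in four ways. -/
theorem doubleWalkCount_boundary (m : ℕ) :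
    doubleWalkCount (3 * m + 2) (m + 1) = 4 * doubleWalkCount (3 * m) m := by
  have h1 : ((3 * m + 2).choose (m + 1) : ℤ) = 2 * (3 * m + 2).choose m := by
    exact_mod_cast choose_three_mul_succ m
  have h2 : ((3 * m + 2 : ℤ)) * (3 * m + 1).choose m = (2 * m + 2) * (3 * m + 2).choose m := by
    exact_mod_cast choose_three_mul_pred m
  have h3 : ((3 * m + 2 + 1).choose (m + 1) : ℤ) =
      (3 * m + 2).choose m + (3 * m + 2).choose (m + 1) := by
    exact_mod_cast Nat.choose_succ_succ _ _
  simp only [doubleWalkCount]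
  rw [show 3 * m + 2 + 2 = (3 * m + 2 + 1) + 1 by ring, partialRowSum_succ_left,
    partialRowSum_succ_left, partialRowSum_succ_right, h3, h1]
  push_cast
  linear_combination 4 * h2

theorem returnCount_root (d : ℕ) :
    returnCount (1, 1) (d + 3) =
      returnCount (fibStep (1, 1) true) (d + 2) + 4 * returnCount (1, 1) d := by
  have h1 : fibStep (1, 1) false = (1, 0) := by simp [fibStep]
  have h2 : ∀ b, fibStep (1, 0) b = (0, 1) := by simp [fibStep, Nat.dist]
  have h3 : ∀ b, fibStep (0, 1) b = (1, 1) := by simp [fibStep, Nat.dist]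
  rw [returnCount_succ, h1, returnCount_succ (1, 0), h2, h2, returnCount_succ (0, 1), h3, h3]
  ring

/-- Outer induction on m handles right branches and detours, inner induction on k handles left
branches. -/
theorem two_mul_returnCount {k : ℕ} {p : ℕ × ℕ} (m : ℕ) (h : HasLevel k p) :
    2 * (returnCount p (k + 3 * m) : ℤ) = doubleWalkCount (k + 3 * m) m := by
  induction m generalizing k p with
  | zero =>
    rw [doubleWalkCount_zero, Nat.mul_zero, Nat.add_zero]
    suffices returnCount p k = 1 by simp [this]
    induction k generalizing p with
    | zero =>
      simp only [HasLevel] at h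
      simp [returnCount_zero, h]
    | succ k ih =>
      rw [returnCount_succ, returnCount_eq_zero h.right (by omega), ih h.2.2.2]
  | succ m ihm =>
    induction k generalizing p with
    | zero =>
      have hr := ihm h.right
      have h0 := ihm h
      simp only [HasLevel] at h
      subst h
      have hs : returnCount (1, 1) (0 + 3 * (m + 1)) =
          returnCount (fibStep (1, 1) true) (0 + 2 + 3 * m) + 4 * returnCount (1, 1) (0 + 3 * m) := by
        rw [show 0 + 3 * (m + 1) = 3 * m + 3 by ring, returnCount_root,
          show 0 + 2 + 3 * m = 3 * m + 2 by ring, Nat.zero_add]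
      rw [hs]
      push_cast
      rw [mul_add, hr, mul_left_comm, h0, show 0 + 3 * (m + 1) = (3 * m + 2) + 1 by ring,
        doubleWalkCount_succ_succ, doubleWalkCount_boundary, Nat.zero_add, Nat.zero_add,
        show 2 + 3 * m = 3 * m + 2 by ring]
      ring
    | succ k ihk =>
      have hr := ihm h.right
      have hl := ihk h.2.2.2
      rw [show k + 1 + 3 * (m + 1) = (k + 3 * (m + 1)) + 1 by ring, returnCount_succ,
        doubleWalkCount_succ_succ, ← hl]
      rw [show k + 1 + 2 + 3 * m = k + 3 * (m + 1) by ring] at hr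
      rw [← hr]
      push_cast
      ring

/-- The number `A_{(1, 1)}(n)` in terms of binomial coefficients. -/
theorem two_mul_fibPairCount (n : ℕ) :
    2 * (fibPairCount 1 1 n : ℤ) =
      (n + 4) * partialRowSum (3 * n + 2) n - (2 * n + 2) * (3 * n + 2).choose n := by
  have h : fibPairCount 1 1 n = returnCount (1, 1) (0 + 3 * n) := by
    have h0 : depthResidue 1 1 = 0 := by simp [depthResidue]
    rw [Nat.zero_add]
    simp only [fibPairCount, h0]
    rfl
  have h1 : HasLevel 0 (1, 1) := by simp [HasLevel]
  have h2 : ((3 * n + 2 : ℤ)) * (3 * n + 1).choose n = (2 * n + 2) * (3 * n + 2).choose n := by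
    exact_mod_cast choose_three_mul_pred n
  rw [h, two_mul_returnCount n h1, Nat.zero_add, doubleWalkCount]
  push_cast
  linear_combination -h2

/-! ### Recurrences in n and a growth bound. -/

theorem partialRowSum_three_mul_succ (n : ℕ) :
    (2 * n + 3) * partialRowSum (3 * (n + 1) + 2) (n + 1) =
      8 * (2 * n + 3) * partialRowSum (3 * n + 2) n - (5 * n + 6) * (3 * n + 2).choose n := by
  have h1 : ((3 * n + 2).choose (n + 1) : ℤ) = 2 * (3 * n + 2).choose n := by
    exact_mod_cast choose_three_mul_succ n
  have h3 : ((3 * n + 2 + 1).choose (n + 1) : ℤ) =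
      (3 * n + 2).choose n + (3 * n + 2).choose (n + 1) := by
    exact_mod_cast Nat.choose_succ_succ _ _
  have h4 : ((3 * n + 2 + 1 + 1).choose (n + 1) : ℤ) * (2 * n + 3) =
      (3 * n + 2 + 1).choose (n + 1) * (3 * n + 4) := by
    have h := Nat.choose_mul_succ_eq (3 * n + 2 + 1) (n + 1)
    rw [show 3 * n + 2 + 1 + 1 - (n + 1) = 2 * n + 3 by omega] at h
    exact_mod_cast h.symm
  rw [show 3 * (n + 1) + 2 = (3 * n + 2 + 1 + 1) + 1 by ring, partialRowSum_succ_left,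
    partialRowSum_succ_left, partialRowSum_succ_left, partialRowSum_succ_right, mul_sub,
    mul_comm (2 * (n : ℤ) + 3) ((3 * n + 2 + 1 + 1).choose (n + 1) : ℤ), h4, h3, h1]
  ring

theorem choose_three_mul_add_two_succ (n : ℕ) :
    ((2 * n + 4) * (2 * n + 3) : ℤ) * (3 * (n + 1) + 2).choose (n + 1) =
      3 * (3 * n + 5) * (3 * n + 4) * (3 * n + 2).choose n := by
  have h1 : ((3 * n + 2).choose (n + 1) : ℤ) = 2 * (3 * n + 2).choose n := by
    exact_mod_cast choose_three_mul_succ n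
  have h3 : ((3 * n + 2 + 1).choose (n + 1) : ℤ) =
      (3 * n + 2).choose n + (3 * n + 2).choose (n + 1) := by
    exact_mod_cast Nat.choose_succ_succ _ _
  have h4 : ((3 * n + 2 + 1 + 1).choose (n + 1) : ℤ) * (2 * n + 3) =
      (3 * n + 2 + 1).choose (n + 1) * (3 * n + 4) := by
    have h := Nat.choose_mul_succ_eq (3 * n + 2 + 1) (n + 1)
    rw [show 3 * n + 2 + 1 + 1 - (n + 1) = 2 * n + 3 by omega] at h
    exact_mod_cast h.symm
  have h5 : ((3 * n + 2 + 1 + 1 + 1).choose (n + 1) : ℤ) * (2 * n + 4) =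
      (3 * n + 2 + 1 + 1).choose (n + 1) * (3 * n + 5) := by
    have h := Nat.choose_mul_succ_eq (3 * n + 2 + 1 + 1) (n + 1)
    rw [show 3 * n + 2 + 1 + 1 + 1 - (n + 1) = 2 * n + 4 by omega] at h
    exact_mod_cast h.symm
  rw [show 3 * (n + 1) + 2 = 3 * n + 2 + 1 + 1 + 1 by ring]
  linear_combination (2 * (n : ℤ) + 3) * h5 + (3 * n + 5) * h4 +
    (3 * n + 5) * (3 * n + 4) * h3 + (3 * n + 5) * (3 * n + 4) * h1

theorem choose_le_partialRowSum (N m : ℕ) : (N.choose m : ℤ) ≤ partialRowSum N m := by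
  rw [partialRowSum]
  exact single_le_sum (f := fun i => (N.choose i : ℤ)) (fun i _ => by positivity)
    (mem_range.2 (Nat.lt_succ_self m))

/-- Chernoff bound: weight the binomial expansion of (1/2 + 1)^(3n+2) by (1/2)^i ≥ (1/2)^n for i ≤
n. -/
theorem partialRowSum_le (n : ℕ) :
    (partialRowSum (3 * n + 2) n : ℝ) ≤ 9 / 4 * (27 / 4 : ℝ) ^ n := by
  have h : (partialRowSum (3 * n + 2) n : ℝ) * (1 / 2) ^ n ≤ (1 / 2 + 1) ^ (3 * n + 2) := by
    rw [add_pow, partialRowSum]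
    push_cast
    rw [sum_mul]
    refine le_trans (sum_le_sum fun i hi => ?_) (sum_le_sum_of_subset_of_nonneg
      (range_subset_range.2 (by omega : n + 1 ≤ 3 * n + 2 + 1)) fun i _ _ => by positivity)
    rw [one_pow, mul_one, mul_comm]
    refine mul_le_mul_of_nonneg_right ?_ (by positivity)
    exact pow_le_pow_of_le_one (by norm_num) (by norm_num) (by simpa [Nat.lt_succ_iff] using hi)
  have h2 : (1 / 2 + 1 : ℝ) ^ (3 * n + 2) = 9 / 4 * (27 / 4 : ℝ) ^ n * (1 / 2) ^ n := by
    rw [pow_add, pow_mul, mul_assoc, ← mul_pow]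
    norm_num
    ring
  rw [h2] at h
  exact le_of_mul_le_mul_right h (by positivity)

/-- A negative value would propagate to at most a negative multiple of r^m, below the allowed order
s^m. No initial value has to be checked. -/
theorem nonneg_of_succ_le_mul {D : ℕ → ℝ} {r s C : ℝ} (hs : 0 < s) (hsr : s < r)
    (hD : ∀ n, 1 ≤ n → D (n + 1) ≤ r * D n) (hC : ∀ n, 1 ≤ n → -(C * s ^ n) ≤ D n)
    {n : ℕ} (hn : 1 ≤ n) : 0 ≤ D n := by
  have hr : 0 < r := hs.trans hsr
  have h1 : ∀ m, D (n + m) ≤ r ^ m * D n := by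
    intro m
    induction m with
    | zero => simp
    | succ m ih =>
      calc D (n + (m + 1)) ≤ r * D (n + m) := hD (n + m) (by omega)
        _ ≤ r * (r ^ m * D n) := by gcongr
        _ = r ^ (m + 1) * D n := by ring
  have h2 : Tendsto (fun m : ℕ => -(C * s ^ n) * (s / r) ^ m) atTop (𝓝 (-(C * s ^ n) * 0)) :=
    (tendsto_pow_atTop_nhds_zero_of_lt_one (by positivity) ((div_lt_one hr).2 hsr)).const_mul _
  rw [mul_zero] at h2
  refine le_of_tendsto' h2 fun m => ?_
  have h3 := (hC (n + m) (by omega)).trans (h1 m)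
  rw [div_pow, mul_div_assoc', div_le_iff₀ (by positivity)]
  calc -(C * s ^ n) * s ^ m = -(C * s ^ (n + m)) := by ring
    _ ≤ _ := h3
    _ = _ := by ring

/-! ### Rational bounds for the row sum over its last term. -/

/-- The real number `C(3 n + 2, n)`. -/
noncomputable def lastTerm (n : ℕ) : ℝ := ((3 * n + 2).choose n : ℝ)

/-- The real number `∑ i ≤ n, C(3 n + 2, i)`. -/
noncomputable def rowSum (n : ℕ) : ℝ := (partialRowSum (3 * n + 2) n : ℝ)

theorem lastTerm_pos (n : ℕ) : 0 < lastTerm n := by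
  have : 0 < (3 * n + 2).choose n := Nat.choose_pos (by omega)
  simpa [lastTerm] using this

theorem lastTerm_le_rowSum (n : ℕ) : lastTerm n ≤ rowSum n := by
  have h := choose_le_partialRowSum (3 * n + 2) n
  rw [lastTerm, rowSum]
  exact_mod_cast h

theorem rowSum_le (n : ℕ) : rowSum n ≤ 9 / 4 * (27 / 4 : ℝ) ^ n := partialRowSum_le n

theorem rowSum_succ (n : ℕ) :
    rowSum (n + 1) = 8 * rowSum n - (5 * n + 6) / (2 * n + 3) * lastTerm n := by
  have h := congrArg (fun z : ℤ => (z : ℝ)) (partialRowSum_three_mul_succ n)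
  push_cast at h
  rw [rowSum, rowSum, lastTerm]
  field_simp
  linear_combination h

theorem lastTerm_succ (n : ℕ) :
    lastTerm (n + 1) =
      3 * (3 * n + 5) * (3 * n + 4) / ((2 * n + 4) * (2 * n + 3)) * lastTerm n := by
  have h := congrArg (fun z : ℤ => (z : ℝ)) (choose_three_mul_add_two_succ n)
  push_cast at h
  rw [lastTerm, lastTerm]
  field_simp
  linear_combination h

theorem fibPairCount_eq (n : ℕ) :
    (fibPairCount 1 1 n : ℝ) = ((n + 4) * rowSum n - (2 * n + 2) * lastTerm n) / 2 := by
  have h := congrArg (fun z : ℤ => (z : ℝ)) (two_mul_fibPairCount n)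
  push_cast at h
  rw [rowSum, lastTerm]
  linarith

/-- Substituting n = m + 1 turns the polynomials below into ones with positive coefficients in m,
which `positivity` settles. -/
theorem exists_cast_eq_add_one {n : ℕ} (hn : 1 ≤ n) : ∃ m : ℝ, 0 ≤ m ∧ (n : ℝ) = m + 1 :=
  ⟨n - 1, by rw [sub_nonneg]; exact_mod_cast hn, by ring⟩

/-- The factor is chosen so that (n+4)S - (2n+2)C becomes (36/n)(1 - 56/(3n) + 450/n^2)C. The value
450 slightly exceeds the true coefficient 1282/3, which leaves the slack seen in `key`. -/
theorem rowSum_upper {n : ℕ} (hn : 1 ≤ n) :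
    rowSum n ≤ 2 * ((n + 1) * n ^ 3 + 18 * (n ^ 2 - 56 / 3 * n + 450)) / ((n + 4) * n ^ 3) *
      lastTerm n := by
  rw [← sub_nonneg]
  refine nonneg_of_succ_le_mul (D := fun n : ℕ =>
    2 * (((n : ℝ) + 1) * n ^ 3 + 18 * (n ^ 2 - 56 / 3 * n + 450)) / ((n + 4) * n ^ 3) *
      lastTerm n - rowSum n) (r := 8) (s := 27 / 4) (C := 9 / 4) (by norm_num) (by norm_num)
    (fun n hn => ?_) (fun n hn => ?_) hn
  · obtain ⟨m, hm, hnm⟩ := exists_cast_eq_add_one hn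
    rw [rowSum_succ, lastTerm_succ, ← sub_nonneg]
    push_cast
    rw [hnm]
    have key : 8 * (2 * ((m + 1 + 1) * (m + 1) ^ 3 + 18 * ((m + 1) ^ 2 - 56 / 3 * (m + 1) + 450)) /
          ((m + 1 + 4) * (m + 1) ^ 3)) - (5 * (m + 1) + 6) / (2 * (m + 1) + 3) -
        2 * ((m + 1 + 1 + 1) * (m + 1 + 1) ^ 3 +
          18 * ((m + 1 + 1) ^ 2 - 56 / 3 * (m + 1 + 1) + 450)) /
          ((m + 1 + 1 + 4) * (m + 1 + 1) ^ 3) *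
          (3 * (3 * (m + 1) + 5) * (3 * (m + 1) + 4) /
            ((2 * (m + 1) + 4) * (2 * (m + 1) + 3))) =
        (4080 * m ^ 6 + 2327784 * m ^ 5 + 29062272 * m ^ 4 + 140314704 * m ^ 3 +
          328011888 * m ^ 2 + 373346952 * m + 166687200) /
        ((m + 1 + 4) * (m + 1) ^ 3 * ((m + 1 + 1 + 4) * (m + 1 + 1) ^ 3) *
          ((2 * (m + 1) + 4) * (2 * (m + 1) + 3))) := by
      field_simp
      ring
    have hpos := mul_nonneg (le_of_le_of_eq (b := _) (by positivity) key.symm)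
      (lastTerm_pos n).le
    linarith
  · have h1 := rowSum_le n
    have h2 : 0 ≤ 2 * (((n : ℝ) + 1) * n ^ 3 + 18 * (n ^ 2 - 56 / 3 * n + 450)) /
        ((n + 4) * n ^ 3) * lastTerm n := by
      have h3 : 0 ≤ (n : ℝ) ^ 2 - 56 / 3 * n + 450 := by nlinarith [sq_nonneg ((n : ℝ) - 28 / 3)]
      have h4 := (lastTerm_pos n).le
      positivity
    linarith

theorem rowSum_lower {n : ℕ} (hn : 1 ≤ n) :
    2 * ((n + 1) * n ^ 2 + 18 * (n - 56 / 3)) / ((n + 4) * n ^ 2) * lastTerm n ≤ rowSum n := by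
  rw [← sub_nonneg]
  refine nonneg_of_succ_le_mul (D := fun n : ℕ => rowSum n -
    2 * (((n : ℝ) + 1) * n ^ 2 + 18 * (n - 56 / 3)) / ((n + 4) * n ^ 2) * lastTerm n)
    (r := 8) (s := 27 / 4) (C := 18) (by norm_num) (by norm_num)
    (fun n hn => ?_) (fun n hn => ?_) hn
  · obtain ⟨m, hm, hnm⟩ := exists_cast_eq_add_one hn
    rw [rowSum_succ, lastTerm_succ, ← sub_nonneg]
    push_cast
    rw [hnm]
    have key : (5 * (m + 1) + 6) / (2 * (m + 1) + 3) -
        8 * (2 * ((m + 1 + 1) * (m + 1) ^ 2 + 18 * (m + 1 - 56 / 3)) /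
          ((m + 1 + 4) * (m + 1) ^ 2)) +
        2 * ((m + 1 + 1 + 1) * (m + 1 + 1) ^ 2 + 18 * (m + 1 + 1 - 56 / 3)) /
          ((m + 1 + 1 + 4) * (m + 1 + 1) ^ 2) *
          (3 * (3 * (m + 1) + 5) * (3 * (m + 1) + 4) /
            ((2 * (m + 1) + 4) * (2 * (m + 1) + 3))) =
        (76920 * m ^ 6 + 1058016 * m ^ 5 + 5832528 * m ^ 4 + 16533696 * m ^ 3 +
          25423512 * m ^ 2 + 20070048 * m + 6328800) /
        ((m + 1 + 4) * (m + 1) ^ 3 * ((m + 1 + 1 + 4) * (m + 1 + 1) ^ 3) *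
          ((2 * (m + 1) + 4) * (2 * (m + 1) + 3))) := by
      field_simp
      ring
    have hpos := mul_nonneg (le_of_le_of_eq (b := _) (by positivity) key.symm)
      (lastTerm_pos n).le
    linarith
  · have h1 := (lastTerm_le_rowSum n).trans (rowSum_le n)
    -- A crude factor 8 suffices; it gives the constant 18 = 8 · 9/4.
    have h2 : 2 * (((n : ℝ) + 1) * n ^ 2 + 18 * (n - 56 / 3)) / ((n + 4) * n ^ 2) ≤ 8 := by
      obtain ⟨m, hm, hnm⟩ := exists_cast_eq_add_one hn
      rw [hnm, div_le_iff₀ (by positivity), ← sub_nonneg]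
      ring_nf
      positivity
    have h3 := mul_le_mul_of_nonneg_right h2 (lastTerm_pos n).le
    have h4 := lastTerm_le_rowSum n
    have h5 := lastTerm_pos n
    linarith

theorem fibPairCount_upper {n : ℕ} (hn : 1 ≤ n) :
    (fibPairCount 1 1 n : ℝ) ≤
      18 / n * (1 - 56 / (3 * n) + 450 / n ^ 2) * lastTerm n := by
  have hn0 : (0 : ℝ) < n := by exact_mod_cast hn
  rw [fibPairCount_eq]
  have h := mul_le_mul_of_nonneg_left (rowSum_upper hn) (by positivity : (0 : ℝ) ≤ n + 4)
  calc _ ≤ (((n : ℝ) + 4) * (2 * ((n + 1) * n ^ 3 + 18 * (n ^ 2 - 56 / 3 * n + 450)) /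
        ((n + 4) * n ^ 3) * lastTerm n) - (2 * n + 2) * lastTerm n) / 2 := by linarith
    _ = _ := by field_simp; ring

theorem fibPairCount_lower {n : ℕ} (hn : 1 ≤ n) :
    18 / n * (1 - 56 / (3 * n)) * lastTerm n ≤ (fibPairCount 1 1 n : ℝ) := by
  have hn0 : (0 : ℝ) < n := by exact_mod_cast hn
  rw [fibPairCount_eq]
  have h := mul_le_mul_of_nonneg_left (rowSum_lower hn) (by positivity : (0 : ℝ) ≤ n + 4)
  calc _ = (((n : ℝ) + 4) * (2 * ((n + 1) * n ^ 2 + 18 * (n - 56 / 3)) /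
        ((n + 4) * n ^ 2) * lastTerm n) - (2 * n + 2) * lastTerm n) / 2 := by field_simp; ring
    _ ≤ _ := by linarith

/-! ### Asymptotics of C(3n+2, n). -/

/-- The normalization of `C(3 n + 2, n)` with a finite positive limit. -/
noncomputable def scaledLastTerm (n : ℕ) : ℝ := lastTerm n * √n / (27 / 4 : ℝ) ^ n

theorem scaledLastTerm_pos {n : ℕ} (hn : 1 ≤ n) : 0 < scaledLastTerm n := by
  have := lastTerm_pos n
  have hn0 : (0 : ℝ) < n := by exact_mod_cast hn
  rw [scaledLastTerm]
  positivity

/-- Squaring removes √n, so that ratios are rational in n. -/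
theorem scaledLastTerm_sq_succ {n : ℕ} (hn : 1 ≤ n) :
    scaledLastTerm (n + 1) ^ 2 =
      (4 * (3 * n + 5) * (3 * n + 4) / (9 * ((2 * n + 4) * (2 * n + 3)))) ^ 2 * ((n + 1) / n) *
        scaledLastTerm n ^ 2 := by
  have hn0 : (0 : ℝ) < n := by exact_mod_cast hn
  simp only [scaledLastTerm, lastTerm_succ, div_pow, mul_pow]
  rw [Real.sq_sqrt (by positivity), Real.sq_sqrt (by positivity), pow_succ]
  push_cast
  field_simp
  ring

theorem tendsto_scaledLastTerm :
    Tendsto scaledLastTerm atTop (𝓝 (27 / (8 * √(3 * Real.pi)))) := by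
  have hS := Stirling.tendsto_stirlingSeq_sqrt_pi
  have h3 : Tendsto (fun n : ℕ => 3 * n) atTop atTop :=
    tendsto_id.const_mul_atTop' (by norm_num)
  have h2 : Tendsto (fun n : ℕ => 2 * n) atTop atTop :=
    tendsto_id.const_mul_atTop' (by norm_num)
  have hpi := Real.pi_pos
  have hq : Tendsto (fun n : ℕ => Stirling.stirlingSeq (3 * n) /
      (Stirling.stirlingSeq n * Stirling.stirlingSeq (2 * n))) atTop
      (𝓝 (√Real.pi / (√Real.pi * √Real.pi))) :=
    (hS.comp h3).div (hS.mul (hS.comp h2)) (by positivity)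
  have hr : Tendsto (fun n : ℕ => (3 * (n : ℝ) + 2) * (3 * n + 1) / ((2 * n + 2) * (2 * n + 1)))
      atTop (𝓝 ((3 + 2 * 0) * (3 + 0) / ((2 + 2 * 0) * (2 + 0)))) := by
    have hi : Tendsto (fun n : ℕ => ((n : ℝ))⁻¹) atTop (𝓝 0) := tendsto_inv_atTop_nhds_zero_nat
    refine Tendsto.congr' ?_ ((((hi.const_mul 2).const_add 3).mul (hi.const_add 3)).div
      (((hi.const_mul 2).const_add 2).mul (hi.const_add 2)) (by norm_num))
    filter_upwards [eventually_ge_atTop 1] with n hn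
    have hn0 : (0 : ℝ) < n := by exact_mod_cast hn
    simp only [Pi.div_apply]
    field_simp
  -- √3/2 collects the Stirling roots √(6n)·√n / (√(2n)·√(4n)); the rational factor, of limit 9/4,
  -- is C(3n+2, n)/C(3n, n).
  have hlim : √3 / 2 * (√Real.pi / (√Real.pi * √Real.pi)) *
      ((3 + 2 * 0) * (3 + 0) / ((2 + 2 * 0) * (2 + 0))) = 27 / (8 * √(3 * Real.pi)) := by
    rw [Real.sqrt_mul (by norm_num)]
    have : √3 * √3 = 3 := Real.mul_self_sqrt (by norm_num)
    field_simp
    linear_combination 72 * this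
  rw [← hlim]
  refine Tendsto.congr' ?_ ((hq.const_mul (√3 / 2)).mul hr)
  filter_upwards [eventually_ge_atTop 1] with n hn
  have hn0 : (0 : ℝ) < n := by exact_mod_cast hn
  have hc : lastTerm n = (3 * (n : ℝ) + 2) * (3 * n + 1) / ((2 * n + 2) * (2 * n + 1)) *
      ((3 * n).factorial / (n.factorial * (2 * n).factorial)) := by
    rw [lastTerm, Nat.cast_choose ℝ (by omega), show 3 * n + 2 - n = 2 * n + 1 + 1 by omega,
      show 3 * n + 2 = 3 * n + 1 + 1 by ring]
    simp only [Nat.factorial_succ]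
    push_cast
    field_simp
    ring
  rw [scaledLastTerm, hc]
  simp only [Stirling.stirlingSeq]
  have e1 : √(2 * ((3 * n : ℕ) : ℝ)) = √2 * √3 * √n := by
    push_cast
    rw [Real.sqrt_mul (by norm_num), Real.sqrt_mul (by norm_num), mul_assoc]
  have e2 : √(2 * ((2 * n : ℕ) : ℝ)) = 2 * √n := by
    push_cast
    rw [← mul_assoc, Real.sqrt_mul (by norm_num), show (2 : ℝ) * 2 = 2 ^ 2 by norm_num,
      Real.sqrt_sq (by norm_num)]
  have e3 : √(2 * (n : ℝ)) = √2 * √n := Real.sqrt_mul (by norm_num) _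
  have e4 : (27 / 4 : ℝ) ^ n = 3 ^ (3 * n) / 2 ^ (2 * n) := by
    rw [pow_mul, pow_mul, ← div_pow]
    norm_num
  rw [e1, e2, e3, e4]
  push_cast
  simp only [mul_div_assoc, mul_pow]
  have hE : (0 : ℝ) < (n / Real.exp 1) ^ n := by positivity
  have e5 : ((n : ℝ) / Real.exp 1) ^ (3 * n) =
      ((n : ℝ) / Real.exp 1) ^ n * ((n : ℝ) / Real.exp 1) ^ (2 * n) := by
    rw [← pow_add]; congr 1; ring
  rw [e5]
  have hF : (0 : ℝ) < (n / Real.exp 1) ^ (2 * n) := by positivity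
  generalize ((n : ℝ) / Real.exp 1) ^ (2 * n) = y at *
  generalize ((n : ℝ) / Real.exp 1) ^ n = x at *
  field_simp

theorem le_of_tendsto_of_succ_le {u : ℕ → ℝ} {l : ℝ} (hu : Tendsto u atTop (𝓝 l))
    (h : ∀ n, 1 ≤ n → u (n + 1) ≤ u n) {n : ℕ} (hn : 1 ≤ n) : l ≤ u n := by
  have ha : Antitone fun m => u (m + 1) := antitone_nat_of_succ_le fun m => h (m + 1) (by omega)
  have := ha.le_of_tendsto ((tendsto_add_atTop_iff_nat 1).2 hu) (n - 1)
  rwa [Nat.sub_add_cancel hn] at this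

/-- The quotient by 1 - 43/(72n) decreases to its limit, hence stays above it. -/
theorem scaledLastTerm_lower {n : ℕ} (hn : 1 ≤ n) :
    27 / (8 * √(3 * Real.pi)) * (1 - 43 / (72 * n)) ≤ scaledLastTerm n := by
  have hpos : ∀ n : ℕ, 1 ≤ n → 0 < 1 - 43 / (72 * (n : ℝ)) := by
    intro n hn
    have hn1 : (1 : ℝ) ≤ n := by exact_mod_cast hn
    rw [sub_pos, div_lt_one (by positivity)]
    linarith
  have hi : Tendsto (fun n : ℕ => 1 - 43 / (72 * (n : ℝ))) atTop (𝓝 (1 - 43 / 72 * 0)) := by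
    refine (((tendsto_inv_atTop_nhds_zero_nat (𝕜 := ℝ)).const_mul (43 / 72)).const_sub 1).congr
      fun n => ?_
    rw [div_mul_eq_div_div, div_eq_mul_inv _ (n : ℝ)]
  have hlim := tendsto_scaledLastTerm.div hi (by norm_num)
  rw [mul_zero, sub_zero, div_one] at hlim
  rw [← le_div_iff₀ (hpos n hn)]
  refine le_of_tendsto_of_succ_le hlim (fun n hn => ?_) hn
  have hs := scaledLastTerm_pos hn
  have hp := hpos n hn
  have hp' := hpos (n + 1) (by omega)
  simp only [Pi.div_apply]
  rw [div_le_div_iff₀ hp' hp]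
  refine le_of_sq_le_sq ?_ (by positivity)
  rw [mul_pow, mul_pow, scaledLastTerm_sq_succ hn, ← sub_nonneg]
  push_cast
  obtain ⟨m, hm, hnm⟩ := exists_cast_eq_add_one hn
  rw [hnm]
  have key : (1 - 43 / (72 * (m + 1 + 1))) ^ 2 -
      (4 * (3 * (m + 1) + 5) * (3 * (m + 1) + 4) /
        (9 * ((2 * (m + 1) + 4) * (2 * (m + 1) + 3)))) ^ 2 * ((m + 1 + 1) / (m + 1)) *
        (1 - 43 / (72 * (m + 1))) ^ 2 =
      (49041 / 2 * m ^ 10 + 6969185 / 16 * m ^ 9 + 54741287 / 16 * m ^ 8 +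
        2250514133 / 144 * m ^ 7 + 2203661849 / 48 * m ^ 6 + 13026519803 / 144 * m ^ 5 +
        17400769921 / 144 * m ^ 4 + 15521344487 / 144 * m ^ 3 + 8821985929 / 144 * m ^ 2 +
        19964664 * m + 101517193 / 36) /
      ((m + 1 + 1) ^ 4 * (m + 1) ^ 5 * (27 * ((2 * (m + 1) + 4) * (2 * (m + 1) + 3))) ^ 2) := by
    field_simp
    ring
  have hnonneg := mul_nonneg (le_of_le_of_eq (b := _) (by positivity) key.symm)
    (sq_nonneg (scaledLastTerm n))
  linarith

theorem scaledLastTerm_upper {n : ℕ} (hn : 1 ≤ n) :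
    scaledLastTerm n ≤
      27 / (8 * √(3 * Real.pi)) * (1 - 43 / (72 * n) + 3 / (5 * n ^ 2)) := by
  have hpos : ∀ n : ℕ, 1 ≤ n → 0 < 1 - 43 / (72 * (n : ℝ)) + 3 / (5 * (n : ℝ) ^ 2) := by
    intro n hn
    have hn1 : (1 : ℝ) ≤ n := by exact_mod_cast hn
    have h1 : 0 < 1 - 43 / (72 * (n : ℝ)) := by
      rw [sub_pos, div_lt_one (by positivity)]
      linarith
    positivity
  have hi : Tendsto (fun n : ℕ => 1 - 43 / (72 * (n : ℝ)) + 3 / (5 * (n : ℝ) ^ 2)) atTop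
      (𝓝 (1 - 43 / 72 * 0 + 3 / 5 * 0 ^ 2)) := by
    have h0 : Tendsto (fun n : ℕ => ((n : ℝ))⁻¹) atTop (𝓝 0) := tendsto_inv_atTop_nhds_zero_nat
    refine (((h0.const_mul (43 / 72)).const_sub 1).add ((h0.pow 2).const_mul (3 / 5))).congr
      fun n => ?_
    rw [div_mul_eq_div_div, div_mul_eq_div_div, div_eq_mul_inv _ (n : ℝ),
      div_eq_mul_inv _ ((n : ℝ) ^ 2), inv_pow]
  -- With 3/5 above the true coefficient of 1/n^2, the quotient increases to its limit, so its
  -- negative decreases.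
  have hlim := (tendsto_scaledLastTerm.div hi (by norm_num)).neg
  norm_num only [mul_zero, sub_zero, div_one, add_zero] at hlim
  rw [← div_le_iff₀ (hpos n hn), ← neg_le_neg_iff]
  refine le_of_tendsto_of_succ_le hlim (fun n hn => ?_) hn
  have hs := scaledLastTerm_pos hn
  have hs' := scaledLastTerm_pos (n := n + 1) (by omega)
  have hp := hpos n hn
  have hp' := hpos (n + 1) (by omega)
  simp only [Pi.div_apply]
  rw [neg_le_neg_iff, div_le_div_iff₀ hp hp']
  refine le_of_sq_le_sq ?_ (by positivity)
  rw [mul_pow, mul_pow, scaledLastTerm_sq_succ hn, ← sub_nonneg]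
  push_cast
  obtain ⟨m, hm, hnm⟩ := exists_cast_eq_add_one hn
  rw [hnm]
  have key : (4 * (3 * (m + 1) + 5) * (3 * (m + 1) + 4) /
        (9 * ((2 * (m + 1) + 4) * (2 * (m + 1) + 3)))) ^ 2 * ((m + 1 + 1) / (m + 1)) *
        (1 - 43 / (72 * (m + 1)) + 3 / (5 * (m + 1) ^ 2)) ^ 2 -
        (1 - 43 / (72 * (m + 1 + 1)) + 3 / (5 * (m + 1 + 1) ^ 2)) ^ 2 =
      (34731 / 10 * m ^ 10 + 1631071 / 16 * m ^ 9 + 456886849 / 400 * m ^ 8 +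
        24949329091 / 3600 * m ^ 7 + 6241679507 / 240 * m ^ 6 + 230810654029 / 3600 * m ^ 5 +
        382630775159 / 3600 * m ^ 4 + 424847850721 / 3600 * m ^ 3 +
        305073019823 / 3600 * m ^ 2 + 179614347 / 5 * m + 6229582967 / 900) /
      ((m + 1 + 1) ^ 4 * (m + 1) ^ 5 * (27 * ((2 * (m + 1) + 4) * (2 * (m + 1) + 3))) ^ 2) := by
    field_simp
    ring
  have hnonneg := mul_nonneg (le_of_le_of_eq (b := _) (by positivity) key.symm)
    (sq_nonneg (scaledLastTerm n))
  linarith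

/-! ### Combining the two expansions. -/

theorem lastTerm_eq {n : ℕ} (hn : 1 ≤ n) :
    lastTerm n = scaledLastTerm n * ((27 / 4 : ℝ) ^ n / √n) := by
  have hn0 : (0 : ℝ) < n := by exact_mod_cast hn
  rw [scaledLastTerm]
  field_simp

theorem lower_bound {n : ℕ} (hn : 1 ≤ n) :
    243 / (4 * √(3 * Real.pi)) * (1 - 1387 / (72 * n)) * ((27 / 4 : ℝ) ^ n / (n * √n)) <
      (fibPairCount 1 1 n : ℝ) := by
  have hn0 : (0 : ℝ) < n := by exact_mod_cast hn
  have hpi := Real.pi_pos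
  have hL : 0 < 27 / (8 * √(3 * Real.pi)) := by positivity
  refine lt_of_lt_of_le ?_ (fibPairCount_lower hn)
  rw [lastTerm_eq hn]
  have key : 27 / (8 * √(3 * Real.pi)) * (1 - 1387 / (72 * n)) <
      (1 - 56 / (3 * n)) * scaledLastTerm n := by
    obtain ⟨m, hm, hnm⟩ := exists_cast_eq_add_one hn
    -- The factor is negative for n ≤ 18; there the upper bound on `scaledLastTerm` is the one
    -- needed.
    rcases le_total 0 (1 - 56 / (3 * (n : ℝ))) with h | h
    · refine lt_of_lt_of_le ?_ (mul_le_mul_of_nonneg_left (scaledLastTerm_lower hn) h)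
      rw [mul_left_comm]
      refine mul_lt_mul_of_pos_left ?_ hL
      rw [← sub_pos]
      have : (1 - 56 / (3 * (n : ℝ))) * (1 - 43 / (72 * n)) - (1 - 1387 / (72 * n)) =
          301 / (27 * n ^ 2) := by
        field_simp
        ring
      rw [this]
      positivity
    · refine lt_of_lt_of_le ?_ (mul_le_mul_of_nonpos_left (scaledLastTerm_upper hn) h)
      rw [mul_left_comm]
      refine mul_lt_mul_of_pos_left ?_ hL
      rw [← sub_pos]
      have : (1 - 56 / (3 * (n : ℝ))) * (1 - 43 / (72 * n) + 3 / (5 * n ^ 2)) -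
          (1 - 1387 / (72 * n)) = (1586 * m + 74) / (135 * n ^ 3) := by
        rw [hnm]
        field_simp
        ring
      rw [this]
      positivity
  calc _ = 27 / (8 * √(3 * Real.pi)) * (1 - 1387 / (72 * n)) *
        (18 * ((27 / 4 : ℝ) ^ n / (n * √n))) := by ring
    _ < (1 - 56 / (3 * n)) * scaledLastTerm n * (18 * ((27 / 4 : ℝ) ^ n / (n * √n))) :=
      mul_lt_mul_of_pos_right key (by positivity)
    _ = _ := by field_simp

theorem upper_bound {n : ℕ} (hn : 1 ≤ n) :
    (fibPairCount 1 1 n : ℝ) <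
      243 / (4 * √(3 * Real.pi)) * (1 - 1387 / (72 * n) + 5548 / (9 * n ^ 2)) *
        ((27 / 4 : ℝ) ^ n / (n * √n)) := by
  have hn0 : (0 : ℝ) < n := by exact_mod_cast hn
  have hpi := Real.pi_pos
  have hL : 0 < 27 / (8 * √(3 * Real.pi)) := by positivity
  refine lt_of_le_of_lt (fibPairCount_upper hn) ?_
  rw [lastTerm_eq hn]
  obtain ⟨m, hm, hnm⟩ := exists_cast_eq_add_one hn
  have h : 0 ≤ 1 - 56 / (3 * (n : ℝ)) + 450 / n ^ 2 := by
    have : 1 - 56 / (3 * (n : ℝ)) + 450 / n ^ 2 =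
        ((n - 28 / 3) ^ 2 + 3266 / 9) / n ^ 2 := by
      field_simp
      ring
    rw [this]
    positivity
  have key : (1 - 56 / (3 * n) + 450 / n ^ 2) * scaledLastTerm n <
      27 / (8 * √(3 * Real.pi)) * (1 - 1387 / (72 * n) + 5548 / (9 * n ^ 2)) := by
    refine lt_of_le_of_lt (mul_le_mul_of_nonneg_left (scaledLastTerm_upper hn) h) ?_
    rw [mul_left_comm]
    refine mul_lt_mul_of_pos_left ?_ hL
    rw [← sub_pos]
    have : (1 - 1387 / (72 * (n : ℝ)) + 5548 / (9 * n ^ 2)) -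
        (1 - 56 / (3 * (n : ℝ)) + 450 / n ^ 2) * (1 - 43 / (72 * n) + 3 / (5 * n ^ 2)) =
        ((5548 / 9 - 450 - 3 / 5 - 301 / 27) * m ^ 2 +
          (2 * (5548 / 9 - 450 - 3 / 5 - 301 / 27) + 56 / 5 + 1075 / 4) * m +
          (5548 / 9 - 720 - 3 / 5 - 301 / 27 + 56 / 5 + 1075 / 4)) / n ^ 4 := by
      rw [hnm]
      field_simp
      ring
    rw [this]
    norm_num
    positivity
  calc _ = (1 - 56 / (3 * n) + 450 / n ^ 2) * scaledLastTerm n *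
        (18 * ((27 / 4 : ℝ) ^ n / (n * √n))) := by field_simp
    _ < 27 / (8 * √(3 * Real.pi)) * (1 - 1387 / (72 * n) + 5548 / (9 * n ^ 2)) *
        (18 * ((27 / 4 : ℝ) ^ n / (n * √n))) := mul_lt_mul_of_pos_right key (by positivity)
    _ = _ := by ring

theorem rpow_add_half {x : ℝ} (hx : 0 < x) (k : ℕ) (y : ℝ) (hy : y = k + 1 / 2) :
    x ^ y = x ^ k * √x := by
  rw [hy, Real.rpow_add hx, Real.rpow_natCast, Real.sqrt_eq_rpow]

/-- Used with e = 0 for c_n > 0 and e = 5548/9 for the upper bound; 337041/288 = (243/4)(1387/72).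
-/
theorem main_terms {n : ℕ} (hn : 1 ≤ n) (e : ℝ) :
    243 * (27 / 4 : ℝ) ^ n / (4 * √(3 * Real.pi) * (n : ℝ) ^ (3 / 2 : ℝ))
        - 337041 * (27 / 4 : ℝ) ^ n / (288 * √(3 * Real.pi) * (n : ℝ) ^ (5 / 2 : ℝ))
        + 243 * e / (4 * √(3 * Real.pi)) * ((27 / 4 : ℝ) ^ n / (n : ℝ) ^ (7 / 2 : ℝ)) =
      243 / (4 * √(3 * Real.pi)) * (1 - 1387 / (72 * n) + e / n ^ 2) *
        ((27 / 4 : ℝ) ^ n / (n * √n)) := by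
  have hn0 : (0 : ℝ) < n := by exact_mod_cast hn
  have hpi := Real.pi_pos
  rw [rpow_add_half hn0 1 (3 / 2) (by norm_num), rpow_add_half hn0 2 (5 / 2) (by norm_num),
    rpow_add_half hn0 3 (7 / 2) (by norm_num)]
  field_simp
  ring

theorem theorem2 :
    -- the expansion with two main terms and an error term of the stated order
    ((fun n : ℕ =>
        (fibPairCount 1 1 n : ℝ)
          - (243 * (27 / 4 : ℝ) ^ n / (4 * √(3 * Real.pi) * (n : ℝ) ^ (3 / 2 : ℝ))
            - 337041 * (27 / 4 : ℝ) ^ n / (288 * √(3 * Real.pi) * (n : ℝ) ^ (5 / 2 : ℝ))))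
      =O[Filter.atTop] fun n : ℕ => (27 / 4 : ℝ) ^ n / (n : ℝ) ^ (7 / 2 : ℝ)) ∧
    -- the range of the coefficient of the error term, for all positive integers
    (∃ c : ℕ → ℝ, ∀ n : ℕ, 1 ≤ n →
      (fibPairCount 1 1 n : ℝ)
          = 243 * (27 / 4 : ℝ) ^ n / (4 * √(3 * Real.pi) * (n : ℝ) ^ (3 / 2 : ℝ))
            - 337041 * (27 / 4 : ℝ) ^ n / (288 * √(3 * Real.pi) * (n : ℝ) ^ (5 / 2 : ℝ))
            + c n * ((27 / 4 : ℝ) ^ n / (n : ℝ) ^ (7 / 2 : ℝ)) ∧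
        0 < c n ∧ c n < 1348164 / (36 * √(3 * Real.pi))) ∧
    -- the two-sided bound for all sufficiently large integers
    (∀ᶠ n : ℕ in Filter.atTop,
      243 * (27 / 4 : ℝ) ^ n / (4 * √(3 * Real.pi) * (n : ℝ) ^ (3 / 2 : ℝ))
            * (1 - 1387 / (72 * (n : ℝ)))
          < (fibPairCount 1 1 n : ℝ) ∧
        (fibPairCount 1 1 n : ℝ)
          < 243 * (27 / 4 : ℝ) ^ n / (4 * √(3 * Real.pi) * (n : ℝ) ^ (3 / 2 : ℝ))
            * (1 - 1387 / (72 * (n : ℝ)) + 5548 / (9 * (n : ℝ) ^ 2))) := by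
  have hpi := Real.pi_pos
  have hcoef : ∃ c : ℕ → ℝ, ∀ n : ℕ, 1 ≤ n →
      (fibPairCount 1 1 n : ℝ)
          = 243 * (27 / 4 : ℝ) ^ n / (4 * √(3 * Real.pi) * (n : ℝ) ^ (3 / 2 : ℝ))
            - 337041 * (27 / 4 : ℝ) ^ n / (288 * √(3 * Real.pi) * (n : ℝ) ^ (5 / 2 : ℝ))
            + c n * ((27 / 4 : ℝ) ^ n / (n : ℝ) ^ (7 / 2 : ℝ)) ∧
        0 < c n ∧ c n < 1348164 / (36 * √(3 * Real.pi)) := by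
    refine ⟨fun n => ((fibPairCount 1 1 n : ℝ)
          - (243 * (27 / 4 : ℝ) ^ n / (4 * √(3 * Real.pi) * (n : ℝ) ^ (3 / 2 : ℝ))
            - 337041 * (27 / 4 : ℝ) ^ n / (288 * √(3 * Real.pi) * (n : ℝ) ^ (5 / 2 : ℝ))))
          / ((27 / 4 : ℝ) ^ n / (n : ℝ) ^ (7 / 2 : ℝ)), fun n hn => ?_⟩
    have hn0 : (0 : ℝ) < n := by exact_mod_cast hn
    have hz : 0 < (27 / 4 : ℝ) ^ n / (n : ℝ) ^ (7 / 2 : ℝ) := by positivity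
    refine ⟨?_, ?_, ?_⟩
    · rw [div_mul_cancel₀ _ hz.ne']
      ring
    · refine div_pos ?_ hz
      have h0 := main_terms hn 0
      rw [mul_zero, zero_div, zero_mul, add_zero, zero_div, add_zero] at h0
      rw [h0, sub_pos]
      exact lower_bound hn
    · rw [div_lt_iff₀ hz, sub_lt_iff_lt_add',
        show 1348164 / (36 * √(3 * Real.pi)) = 243 * (5548 / 9) / (4 * √(3 * Real.pi)) by ring,
        main_terms hn, div_div]
      exact upper_bound hn
  refine ⟨?_, hcoef, ?_⟩
  · obtain ⟨c, hc⟩ := hcoef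
    refine Asymptotics.IsBigO.of_bound (1348164 / (36 * √(3 * Real.pi))) ?_
    filter_upwards [eventually_ge_atTop 1] with n hn
    obtain ⟨h1, h2, h3⟩ := hc n hn
    rw [h1, add_sub_cancel_left, norm_mul, Real.norm_of_nonneg h2.le]
    exact mul_le_mul_of_nonneg_right h3.le (norm_nonneg _)
  · filter_upwards [eventually_ge_atTop 1] with n hn
    have hn0 : (0 : ℝ) < n := by exact_mod_cast hn
    have hl := lower_bound hn
    have hu := upper_bound hn
    have hM : 243 * (27 / 4 : ℝ) ^ n / (4 * √(3 * Real.pi) * (n : ℝ) ^ (3 / 2 : ℝ)) =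
        243 / (4 * √(3 * Real.pi)) * ((27 / 4 : ℝ) ^ n / (n * √n)) := by
      rw [rpow_add_half hn0 1 (3 / 2) (by norm_num), pow_one]
      field_simp
    rw [hM, mul_right_comm, mul_right_comm _ _ (_ + _)]
    exact ⟨hl, hu⟩
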